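/- **Setting.** A control-affine system $\Sigma$ is $\dot x=f(x)+Gu$, $y=h(x)+Ju$ with state $x\in\mathbb R^n$, input $u\in\mathbb R^m$, output $y\in\mathbb R^p$, $f,h$ locally Lipschitz, and constant matrices $G$ (of full column rank) and $J$. Let $\mathcal E_\Sigma=\{\bar x:\ f(\bar x)+G\bar u=0\text{ for some }\bar u\}$. For $\bar x\in\mathcal E_\Sigma$ this $\bar u$ is unique and equals $k_u(\bar x)=-(G^{\sf T}G)^{-1}G^{\sf T}f(\bar x)$; put $k_y(\bar x)=h(\bar x)+Jk_u(\bar x)$ and $\mathcal K_\Sigma=\{(k_u(\bar x),k_y(\bar x)):\bar x\in\mathcal E_\Sigma\}$, and write $\bar y\in\mathcal K_\Sigma(\bar u)$ for $(\bar u,\bar y)\in\mathcal K_\Sigma$. For real matrices $Q=Q^{\sf T},S,R=R^{\sf T}$ let $w(u,y)=y^{\sf T}Qy+2y^{\sf T}Su+u^{\sf T}Ru$. $\Sigma$ is *EID* with supply parameters $(Q,S,R)$ and storage functions $V_{\bar x}$ ($\bar x\in\mathcal E_\Sigma$) if each $V_{\bar x}:\mathbb R^n\to\mathbb R_{\ge0}$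 is $C^1$, $V_{\bar x}(\bar x)=0$, and $\nabla V_{\bar x}(x)^{\sf T}(f(x)+Gu)\le w\big(u-k_u(\bar x),\,h(x)+Ju-k_y(\bar x)\big)$ for all $x,u$. $\Sigma$ satisfies the *EID Hill–Moylan conditions* with $V$ and $(Q,S,R)$ if $V:\mathbb R^n\to\mathbb R_{\ge0}$ is $C^1$ and convex and there are an integer $k>0$, $W\in\mathbb R^{k\times m}$ and $\ell:\mathbb R^n\times\mathbb R^n\to\mathbb R^k$ such that for all $x\in\mathbb R^n$, $\bar x\in\mathcal E_\Sigma$ $$[\nabla V(x)-\nabla V(\bar x)]^{\sf T}[f(x)-f(\bar x)]=[h(x)-h(\bar x)]^{\sf T}Q[h(x)-h(\bar x)]-\|\ell(x,\bar x)\|_2^2,$$ $$\tfrac12[\nabla V(x)-\nabla V(\bar x)]^{\sf T}G=[h(x)-h(\bar x)]^{\sf T}(QJ+S)-\ell(x,\bar x)^{\sf T}W,$$ $$W^{\sf T}W=R+J^{\sf T}S+S^{\sf T}J+J^{\sf T}QJ.$$ Write $V_{\bar x}(x)=V(x)-V(\bar x)-\nabla V(\bar x)^{\sf T}(x-\bar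 x)$. $\Sigma$ is *equilibrium-independent observable* if for every $\bar x\in\mathcal E_\Sigma$ the only trajectory on $[0,\infty)$ of $\dot x=f(x)+Gk_u(\bar x)$ along which $h(x)+Jk_u(\bar x)=k_y(\bar x)$ is $x(t)\equiv\bar x$. **Theorem.** Let $\Sigma_1$ (state $\mathbb R^{n_1}$, input $\mathbb R^m$, output $\mathbb R^p$) and $\Sigma_2$ (state $\mathbb R^{n_2}$, input $\mathbb R^p$, output $\mathbb R^m$) be control-affine systems in the negative feedback interconnection $u_1=v_1-y_2$, $u_2=v_2+y_1$, with $I_p+J_1J_2$ nonsingular. This defines the closed-loop control-affine system $\Sigma_{\rm cl}$ with state $(x_1,x_2)$, input $(v_1,v_2)$ and output $(y_1,y_2)$. Suppose that $\Sigma_i$ satisfies the EID Hill–Moylan conditions with $V_i$ and $(Q_i,S_i,R_i)$, $i=1,2$, and that for all constants $\bar v_1\in\mathbb R^m$, $\bar v_2\in\mathbb R^p$ the inclusions $\bar y_1\in\mathcal K_{\Sigma_1}(\bar v_1-\bar y_2)$, $\bar y_2\in\mathcal K_{\Sigma_2}(\bar v_2+\bar y_1)$ have a unique solution $(\bar y_1,\bar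 y_2)$. 1. $\mathcal E_{\Sigma_{\rm cl}}=\mathcal E_{\Sigma_1}\times\mathcal E_{\Sigma_2}$, and for every $\kappa>0$ the closed loop is EID with supply parameters $$Q_{\rm cl}=\begin{bmatrix}Q_1+\kappa R_2&-S_1+\kappa S_2^{\sf T}\\-S_1^{\sf T}+\kappa S_2&R_1+\kappa Q_2\end{bmatrix},\quad S_{\rm cl}=\begin{bmatrix}S_1&\kappa R_2\\-R_1&\kappa S_2\end{bmatrix},\quad R_{\rm cl}=\begin{bmatrix}R_1&0\\0&\kappa R_2\end{bmatrix}$$ and storage functions $V_{\bar x}(x)=V_{1,\bar x_1}(x_1)+\kappa V_{2,\bar x_2}(x_2)$. 2. If moreover $V_1,V_2$ are strictly convex, $\Sigma_1,\Sigma_2$ are equilibrium-independent observable, and $Q_{\rm cl}\prec0$ for some $\kappa>0$, then every $\bar x\in\mathcal E_{\Sigma_{\rm cl}}$, with associated constant input $\bar v=k_u(\bar x)$ of $\Sigma_{\rm cl}$, is the unique closed-loop equilibrium for the input $v=\bar v$ and is locally asymptotically stable. If in addition $V_1$ and $V_2$ are strongly convex, $\bar x$ is globally asymptotically stable. -/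

import Mathlib

open Set Filter Topology Matrix

noncomputable section

/-- The control-affine system `x' = f x + G u`, `y = h x + J u` with state space `ℝⁿ`,
input space `ℝᵐ` and output space `ℝᵖ` (coordinates indexed by the types `n`, `m`, `p`). -/
structure ControlAffine (n m p : Type) [Fintype n] [Fintype m] [Fintype p] where
  /-- drift -/
  f : EuclideanSpace ℝ n → EuclideanSpace ℝ n
  /-- input matrix -/
  G : Matrix n m ℝ
  /-- output map -/
  h : EuclideanSpace ℝ n → EuclideanSpace ℝ p
  /-- throughput matrix -/
  J : Matrix p m ℝ

/-- A matrix acting on a Euclidean (column) vector. -/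
def mulE {m p : Type} [Fintype m] (A : Matrix p m ℝ) (u : EuclideanSpace ℝ m) :
    EuclideanSpace ℝ p :=
  WithLp.toLp 2 (A *ᵥ u.ofLp)

/-- Stacking of two column vectors. -/
def stack {m p : Type} (a : EuclideanSpace ℝ m) (b : EuclideanSpace ℝ p) :
    EuclideanSpace ℝ (m ⊕ p) :=
  WithLp.toLp 2 (Sum.elim a.ofLp b.ofLp)

/-- Upper block of a stacked vector. -/
def upperBlock {m p : Type} (z : EuclideanSpace ℝ (m ⊕ p)) : EuclideanSpace ℝ m :=
  WithLp.toLp 2 (fun i => z.ofLp (Sum.inl i))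

/-- Lower block of a stacked vector. -/
def lowerBlock {m p : Type} (z : EuclideanSpace ℝ (m ⊕ p)) : EuclideanSpace ℝ p :=
  WithLp.toLp 2 (fun i => z.ofLp (Sum.inr i))

/-- The quadratic supply rate `w(u, y) = [y; u]ᵀ [Q S; Sᵀ R] [y; u]`. -/
def supply {m p : Type} [Fintype m] [Fintype p] (Q : Matrix p p ℝ) (S : Matrix p m ℝ)
    (R : Matrix m m ℝ) (u : EuclideanSpace ℝ m) (y : EuclideanSpace ℝ p) : ℝ :=
  inner ℝ (stack y u) (mulE (Matrix.fromBlocks Q S Sᵀ R) (stack y u))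

/-- The function `V_{x̄}(x) = V(x) - V(x̄) - ∇V(x̄)ᵀ (x - x̄)`. -/
def bregman {n : Type} [Fintype n] (V : EuclideanSpace ℝ n → ℝ)
    (xbar x : EuclideanSpace ℝ n) : ℝ :=
  V x - V xbar - inner ℝ (gradient V xbar) (x - xbar)

/-- `x` is a trajectory on `[0, ∞)` of the autonomous differential equation `x' = g x`. -/
def IsTrajectory {n : Type} [Fintype n] (g : EuclideanSpace ℝ n → EuclideanSpace ℝ n)
    (x : ℝ → EuclideanSpace ℝ n) : Prop :=
  ∀ t, 0 ≤ t → HasDerivWithinAt x (g (x t)) (Ici 0) t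

/-- Lyapunov stability of the equilibrium `xbar` of `x' = g x`; the trajectories
starting near `xbar` are also required to exist for all forward time. -/
def LyapunovStable {n : Type} [Fintype n] (g : EuclideanSpace ℝ n → EuclideanSpace ℝ n)
    (xbar : EuclideanSpace ℝ n) : Prop :=
  g xbar = 0 ∧
  ∀ ε > 0, ∃ δ > 0, ∀ x₀, dist x₀ xbar < δ →
    (∃ x, IsTrajectory g x ∧ x 0 = x₀) ∧
    ∀ x, IsTrajectory g x → x 0 = x₀ → ∀ t, 0 ≤ t → dist (x t) xbar < ε

/-- Local asymptotic stability: Lyapunov stability and local attractivity. -/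
def LocallyAsymptoticallyStable {n : Type} [Fintype n]
    (g : EuclideanSpace ℝ n → EuclideanSpace ℝ n) (xbar : EuclideanSpace ℝ n) : Prop :=
  LyapunovStable g xbar ∧
  ∃ δ > 0, ∀ x, IsTrajectory g x → dist (x 0) xbar < δ → Tendsto x atTop (𝓝 xbar)

/-- Global asymptotic stability: Lyapunov stability, and from every initial state
trajectories exist for all forward time and converge to `xbar`. -/
def GloballyAsymptoticallyStable {n : Type} [Fintype n]
    (g : EuclideanSpace ℝ n → EuclideanSpace ℝ n) (xbar : EuclideanSpace ℝ n) : Prop :=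
  LyapunovStable g xbar ∧
  (∀ x₀, ∃ x, IsTrajectory g x ∧ x 0 = x₀) ∧
  ∀ x, IsTrajectory g x → Tendsto x atTop (𝓝 xbar)

namespace ControlAffine

variable {n m p : Type} [Fintype n] [Fintype m] [Fintype p]

/-- The right-hand side `f x + G u`. -/
def field (sys : ControlAffine n m p) (u : EuclideanSpace ℝ m) (x : EuclideanSpace ℝ n) :
    EuclideanSpace ℝ n :=
  sys.f x + mulE sys.G u

/-- The output `h x + J u`. -/
def output (sys : ControlAffine n m p) (u : EuclideanSpace ℝ m) (x : EuclideanSpace ℝ n) :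
    EuclideanSpace ℝ p :=
  sys.h x + mulE sys.J u

/-- `(u, x, y)` is an equilibrium configuration. -/
def IsEquilibriumConfig (sys : ControlAffine n m p) (u : EuclideanSpace ℝ m)
    (x : EuclideanSpace ℝ n) (y : EuclideanSpace ℝ p) : Prop :=
  sys.field u x = 0 ∧ y = sys.output u x

/-- The set of assignable equilibrium points: those `x` for which `f x` lies in the range of
`G`, that is, is annihilated by a full-rank left annihilator of `G`. -/
def assignable (sys : ControlAffine n m p) : Set (EuclideanSpace ℝ n) :=
  {x | ∃ u, sys.field u x = 0}

/-- The equilibrium input map `k_u(x) = -(Gᵀ G)⁻¹ Gᵀ f(x)`. -/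
def ku [DecidableEq m] (sys : ControlAffine n m p) (x : EuclideanSpace ℝ n) :
    EuclideanSpace ℝ m :=
  -mulE ((sys.Gᵀ * sys.G)⁻¹ * sys.Gᵀ) (sys.f x)

/-- The equilibrium output map `k_y(x) = h(x) - J (Gᵀ G)⁻¹ Gᵀ f(x)`. -/
def ky [DecidableEq m] (sys : ControlAffine n m p) (x : EuclideanSpace ℝ n) :
    EuclideanSpace ℝ p :=
  sys.output (sys.ku x) x

/-- The equilibrium input/output relation. -/
def ioRelation (sys : ControlAffine n m p) :
    Set (EuclideanSpace ℝ m × EuclideanSpace ℝ p) :=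
  {uy | ∃ x, sys.IsEquilibriumConfig uy.1 x uy.2}

/-- The system is equilibrium-independent dissipative with supply rate `w`, as certified by the
storage function family `V` (`V xbar` is the storage function for the equilibrium `xbar`).
The dissipation inequality is imposed at all states and input values, hence along all
trajectories for all inputs. -/
def IsEIDWith [DecidableEq m] (sys : ControlAffine n m p)
    (w : EuclideanSpace ℝ m → EuclideanSpace ℝ p → ℝ)
    (V : EuclideanSpace ℝ n → EuclideanSpace ℝ n → ℝ) : Prop :=
  ∀ xbar ∈ sys.assignable,
    ContDiff ℝ 1 (V xbar) ∧ (∀ x, 0 ≤ V xbar x) ∧ V xbar xbar = 0 ∧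
    ∀ x u, inner ℝ (gradient (V xbar) x) (sys.field u x) ≤
      w (u - sys.ku xbar) (sys.output u x - sys.ky xbar)

/-- The Hill–Moylan conditions for equilibrium-independent dissipativity: `V` is nonnegative,
continuously differentiable and convex, and the three algebraic equations are solvable. -/
def HillMoylanEID (sys : ControlAffine n m p) (V : EuclideanSpace ℝ n → ℝ)
    (Q : Matrix p p ℝ) (S : Matrix p m ℝ) (R : Matrix m m ℝ) : Prop :=
  (∀ x, 0 ≤ V x) ∧ ContDiff ℝ 1 V ∧ ConvexOn ℝ univ V ∧
  ∃ k : ℕ, 0 < k ∧ ∃ (W : Matrix (Fin k) m ℝ)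
    (l : EuclideanSpace ℝ n → EuclideanSpace ℝ n → EuclideanSpace ℝ (Fin k)),
    (∀ x, ∀ xbar ∈ sys.assignable,
      inner ℝ (gradient V x - gradient V xbar) (sys.f x - sys.f xbar) =
        inner ℝ (sys.h x - sys.h xbar) (mulE Q (sys.h x - sys.h xbar)) - ‖l x xbar‖ ^ 2) ∧
    (∀ x, ∀ xbar ∈ sys.assignable,
      (1 / 2 : ℝ) • ((gradient V x - gradient V xbar).ofLp ᵥ* sys.G) =
        (sys.h x - sys.h xbar).ofLp ᵥ* (Q * sys.J + S) - (l x xbar).ofLp ᵥ* W) ∧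
    Wᵀ * W = R + sys.Jᵀ * S + Sᵀ * sys.J + sys.Jᵀ * Q * sys.J

/-- Equilibrium-independent observability. -/
def EIObservable [DecidableEq m] (sys : ControlAffine n m p) : Prop :=
  ∀ xbar ∈ sys.assignable, ∀ x : ℝ → EuclideanSpace ℝ n,
    IsTrajectory (sys.field (sys.ku xbar)) x →
    (∀ t, 0 ≤ t → sys.output (sys.ku xbar) (x t) = sys.ky xbar) →
    ∀ t, 0 ≤ t → x t = xbar

end ControlAffine

section Feedback

variable {n₁ n₂ m p : Type} [Fintype n₁] [Fintype n₂] [Fintype m] [Fintype p]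
  [DecidableEq m] [DecidableEq p]

/-- The matrix `D` that resolves the algebraic loop `y₁ = h₁ + J₁ (v₁ - y₂)`,
`y₂ = h₂ + J₂ (v₂ + y₁)`: it gives `[y₁; y₂] = D [h₁ + J₁ v₁; h₂ + J₂ v₂]`. -/
def loopMatrix (J₁ : Matrix p m ℝ) (J₂ : Matrix m p ℝ) : Matrix (p ⊕ m) (p ⊕ m) ℝ :=
  (Matrix.fromBlocks 1 J₁ (-J₂) 1)⁻¹

/-- The interconnection matrix: `[u₁; u₂] = [v₁; v₂] + K [y₁; y₂]` says
`u₁ = v₁ - y₂` and `u₂ = v₂ + y₁`. -/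
def loopGain (m p : Type) [DecidableEq m] [DecidableEq p] : Matrix (m ⊕ p) (p ⊕ m) ℝ :=
  Matrix.fromBlocks 0 (-1) 1 0

/-- The closed loop of the negative feedback interconnection `u₁ = v₁ - y₂`, `u₂ = v₂ + y₁`,
as a control-affine system with state `[x₁; x₂]`, input `[v₁; v₂]` and output `[y₁; y₂]`. -/
def feedback (sys₁ : ControlAffine n₁ m p) (sys₂ : ControlAffine n₂ p m) :
    ControlAffine (n₁ ⊕ n₂) (m ⊕ p) (p ⊕ m) where
  f x := stack (sys₁.f (upperBlock x)) (sys₂.f (lowerBlock x)) +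
    mulE (Matrix.fromBlocks sys₁.G 0 0 sys₂.G * loopGain m p * loopMatrix sys₁.J sys₂.J)
      (stack (sys₁.h (upperBlock x)) (sys₂.h (lowerBlock x)))
  G := Matrix.fromBlocks sys₁.G 0 0 sys₂.G *
    (1 + loopGain m p * loopMatrix sys₁.J sys₂.J * Matrix.fromBlocks sys₁.J 0 0 sys₂.J)
  h x := mulE (loopMatrix sys₁.J sys₂.J) (stack (sys₁.h (upperBlock x)) (sys₂.h (lowerBlock x)))
  J := loopMatrix sys₁.J sys₂.J * Matrix.fromBlocks sys₁.J 0 0 sys₂.J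

/-- `Q_cl`. -/
def Qcl (κ : ℝ) (Q₁ : Matrix p p ℝ) (S₁ : Matrix p m ℝ) (R₁ : Matrix m m ℝ)
    (Q₂ : Matrix m m ℝ) (S₂ : Matrix m p ℝ) (R₂ : Matrix p p ℝ) :
    Matrix (p ⊕ m) (p ⊕ m) ℝ :=
  Matrix.fromBlocks (Q₁ + κ • R₂) (-S₁ + κ • S₂ᵀ) (-S₁ᵀ + κ • S₂) (R₁ + κ • Q₂)

/-- `S_cl`. -/
def Scl (κ : ℝ) (S₁ : Matrix p m ℝ) (R₁ : Matrix m m ℝ)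
    (S₂ : Matrix m p ℝ) (R₂ : Matrix p p ℝ) : Matrix (p ⊕ m) (m ⊕ p) ℝ :=
  Matrix.fromBlocks S₁ (κ • R₂) (-R₁) (κ • S₂)

/-- `R_cl`. -/
def Rcl (κ : ℝ) (R₁ : Matrix m m ℝ) (R₂ : Matrix p p ℝ) : Matrix (m ⊕ p) (m ⊕ p) ℝ :=
  Matrix.fromBlocks R₁ 0 0 (κ • R₂)

end Feedback

/-- The closed loop obeys the interconnection equations: with `y = [y₁; y₂]` its output,
`y₁` and `y₂` are the outputs of the two systems under the inputs `v₁ - y₂` and `v₂ + y₁`,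
and its state evolves by the right-hand sides of the two systems under these inputs. -/
theorem feedback_spec {n₁ n₂ m p : Type} [Fintype n₁] [Fintype n₂] [Fintype m] [Fintype p]
    [DecidableEq m] [DecidableEq p]
    (sys₁ : ControlAffine n₁ m p) (sys₂ : ControlAffine n₂ p m)
    (hJ : IsUnit (1 + sys₁.J * sys₂.J))
    (v : EuclideanSpace ℝ (m ⊕ p)) (x : EuclideanSpace ℝ (n₁ ⊕ n₂)) :
    let y := (feedback sys₁ sys₂).output v x
    let u₁ := upperBlock v - lowerBlock y
    let u₂ := lowerBlock v + upperBlock y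
    upperBlock y = sys₁.output u₁ (upperBlock x) ∧
    lowerBlock y = sys₂.output u₂ (lowerBlock x) ∧
    (feedback sys₁ sys₂).field v x =
      stack (sys₁.field u₁ (upperBlock x)) (sys₂.field u₂ (lowerBlock x)) := by
  intro y u₁ u₂
  obtain ⟨h₁, hh₁⟩ : ∃ a, a = (sys₁.h (upperBlock x)).ofLp := ⟨_, rfl⟩
  obtain ⟨h₂, hh₂⟩ : ∃ a, a = (sys₂.h (lowerBlock x)).ofLp := ⟨_, rfl⟩
  have hM : IsUnit (Matrix.fromBlocks 1 sys₁.J (-sys₂.J) 1).det := by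
    rw [Matrix.det_fromBlocks_one₁₁]
    have : (1 - -sys₂.J * sys₁.J).det = (1 + sys₁.J * sys₂.J).det := by
      rw [Matrix.neg_mul, sub_neg_eq_add, Matrix.det_one_add_mul_comm]
    rw [this]
    exact (Matrix.isUnit_iff_isUnit_det _).1 hJ
  obtain ⟨a, ha⟩ : ∃ a, a = v.ofLp ∘ Sum.inl := ⟨_, rfl⟩
  obtain ⟨b, hb⟩ : ∃ b, b = v.ofLp ∘ Sum.inr := ⟨_, rfl⟩
  have hv : v.ofLp = Sum.elim a b := by rw [ha, hb, Sum.elim_comp_inl_inr]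
  have hy : y.ofLp = loopMatrix sys₁.J sys₂.J *ᵥ
      (Sum.elim h₁ h₂ + Matrix.fromBlocks sys₁.J 0 0 sys₂.J *ᵥ v.ofLp) := by
    simp [y, ControlAffine.output, feedback, mulE, stack, Matrix.mulVec_add, hh₁, hh₂]
  have hy' : Matrix.fromBlocks 1 sys₁.J (-sys₂.J) 1 *ᵥ y.ofLp =
      Sum.elim h₁ h₂ + Matrix.fromBlocks sys₁.J 0 0 sys₂.J *ᵥ v.ofLp := by
    rw [hy, Matrix.mulVec_mulVec, loopMatrix, Matrix.mul_nonsing_inv _ hM, Matrix.one_mulVec]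
  obtain ⟨c, hc⟩ : ∃ c, c = y.ofLp ∘ Sum.inl := ⟨_, rfl⟩
  obtain ⟨d, hd⟩ : ∃ d, d = y.ofLp ∘ Sum.inr := ⟨_, rfl⟩
  have hcd : y.ofLp = Sum.elim c d := by rw [hc, hd, Sum.elim_comp_inl_inr]
  rw [hcd, hv, Matrix.fromBlocks_mulVec, Matrix.fromBlocks_mulVec] at hy'
  have hu : (upperBlock y).ofLp = c := hc.symm
  have hl : (lowerBlock y).ofLp = d := hd.symm
  have hu₁ : u₁.ofLp = a - d := by rw [ha, ← hl]; rfl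
  have hu₂ : u₂.ofLp = b + c := by rw [hb, ← hu]; rfl
  have hF : ((feedback sys₁ sys₂).field v x).ofLp =
      Sum.elim (sys₁.f (upperBlock x)).ofLp (sys₂.f (lowerBlock x)).ofLp +
      Matrix.fromBlocks sys₁.G 0 0 sys₂.G *ᵥ (v.ofLp + loopGain m p *ᵥ y.ofLp) := by
    rw [hy]
    simp [ControlAffine.field, feedback, mulE, stack, Matrix.mulVec_add, Matrix.mul_add,
      Matrix.add_mulVec, Matrix.mulVec_mulVec, Matrix.mul_assoc, hh₁, hh₂]
    abel
  refine ⟨?_, ?_, ?_⟩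
  · ext i
    have := congrFun hy' (Sum.inl i)
    simp at this
    simp only [ControlAffine.output, mulE, PiLp.add_apply, hu₁, Matrix.mulVec_sub, ← hh₁, hu,
      Pi.sub_apply]
    linarith
  · ext i
    have := congrFun hy' (Sum.inr i)
    simp [Matrix.neg_mulVec] at this
    simp only [ControlAffine.output, mulE, PiLp.add_apply, hu₂, Matrix.mulVec_add, ← hh₂, hl,
      Pi.add_apply]
    linarith
  · apply WithLp.ofLp_injective
    rw [hF, hv, hcd, loopGain]
    ext i
    rcases i with i | i <;>
      simp [Matrix.fromBlocks_mulVec, ControlAffine.field, mulE, stack, hu₁, hu₂,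
        Matrix.neg_mulVec, Matrix.mulVec_add, Matrix.mulVec_neg, sub_eq_add_neg]

end

/-! Each subsystem is dissipative by completing a square: by the three Hill–Moylan equations, the
supply rate minus the derivative of the Bregman distance `bregman V xbar` along the field equals `‖l
+ W (u - ubar)‖²` (`HillMoylanEID.inner_le_supply`). Under `u₁ = v₁ - y₂`, `u₂ = v₂ + y₁` the supply
rates, weighted by `1` and `κ`, add up to the closed-loop supply rate (`supply_closedLoop`), so the
sum of the Bregman distances with the same weights is a storage function.

For the constant input `vbar` this bounds the derivative of the composite storage by the quadratic
form of `Qcl` in the output deviation. If `Qcl` is negative definite, the derivative can vanish only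
where the closed-loop output has its equilibrium value. While this holds, both subsystems receive
their equilibrium inputs, the loop decouples, and observability of each part forces the state to be
`xbar`. Applied to constant trajectories, this yields uniqueness of the equilibrium; applied to
limit trajectories, it is the invariance step of the Krasovskii–LaSalle argument.

Strict convexity makes the Bregman distances positive definite. A convex function on a
finite-dimensional space with a strict zero minimum grows at least linearly
(`ConvexOn.exists_linear_growth`), so its sublevel sets are bounded. Hence trajectories exist for
all forward time, LaSalle's argument applies from every initial state, and local stability follows
from global stability. -/

/-- The product of a locally Lipschitz scalar function and a locally Lipschitz map. -/
theorem LocallyLipschitz.smul_real {X E : Type*} [PseudoEMetricSpace X]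
    [NormedAddCommGroup E] [NormedSpace ℝ E] {φ : X → ℝ} {g : X → E}
    (hφ : LocallyLipschitz φ) (hg : LocallyLipschitz g) :
    LocallyLipschitz (fun x => φ x • g x) := by
  have h : ContDiff ℝ 1 (fun q : ℝ × E => q.1 • q.2) := contDiff_fst.smul contDiff_snd
  exact h.locallyLipschitz.comp (hφ.prodMk hg)

/-! ### Forward existence, Gronwall estimates and monotonicity along trajectories -/

section ODE

variable {n : Type} [Fintype n]

theorem LocallyLipschitz.exists_lipschitzOnWith_closedBall
    {g : EuclideanSpace ℝ n → EuclideanSpace ℝ n} (hg : LocallyLipschitz g)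
    (c : EuclideanSpace ℝ n) (r : ℝ) :
    ∃ K, LipschitzOnWith K g (Metric.closedBall c r) :=
  LocallyLipschitzOn.exists_lipschitzOnWith_of_compact (isCompact_closedBall c r)
    (hg.locallyLipschitzOn)

/-- A bounded locally Lipschitz vector field has solutions on every interval `[0, T]`. -/
theorem exists_solution_Icc_of_bounded {g : EuclideanSpace ℝ n → EuclideanSpace ℝ n}
    (hg : LocallyLipschitz g) {M : ℝ} (hM : ∀ x, ‖g x‖ ≤ M) (x₀ : EuclideanSpace ℝ n)
    {T : ℝ} (hT : 0 ≤ T) :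
    ∃ x : ℝ → EuclideanSpace ℝ n, x 0 = x₀ ∧
      ∀ t ∈ Icc 0 T, HasDerivWithinAt x (g (x t)) (Icc 0 T) t := by
  have hM0 : 0 ≤ M := (norm_nonneg _).trans (hM x₀)
  -- At speed at most `M` a solution travels at most `M * T`, so on this ball Picard–Lindelöf covers
  -- all of `[0, T]` at once.
  obtain ⟨K, hK⟩ := hg.exists_lipschitzOnWith_closedBall x₀ (M * T)
  have hPL : IsPicardLindelof (fun _ => g) (tmin := 0) (tmax := T) ⟨0, left_mem_Icc.2 hT⟩ x₀
      ⟨M * T, by positivity⟩ 0 ⟨M, hM0⟩ K :=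
    { lipschitzOnWith := fun _ _ => hK
      continuousOn := fun _ _ => continuousOn_const
      norm_le := fun _ _ x _ => hM x
      mul_max_le := by simp [hT]; exact le_rfl }
  obtain ⟨x, hx0, hx⟩ := hPL.exists_eq_forall_mem_Icc_hasDerivWithinAt₀
  exact ⟨x, hx0, hx⟩

/-- Two solutions on `[0, T]` that stay in a set on which the vector field is Lipschitz. -/
theorem dist_le_of_solutions_Icc {g : EuclideanSpace ℝ n → EuclideanSpace ℝ n}
    {S : Set (EuclideanSpace ℝ n)} {K : NNReal} (hK : LipschitzOnWith K g S)
    {x y : ℝ → EuclideanSpace ℝ n} {T : ℝ}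
    (hx : ∀ t ∈ Icc 0 T, HasDerivWithinAt x (g (x t)) (Icc 0 T) t)
    (hy : ∀ t ∈ Icc 0 T, HasDerivWithinAt y (g (y t)) (Icc 0 T) t)
    (hxS : ∀ t ∈ Icc 0 T, x t ∈ S) (hyS : ∀ t ∈ Icc 0 T, y t ∈ S) :
    ∀ t ∈ Icc 0 T, dist (x t) (y t) ≤ dist (x 0) (y 0) * Real.exp (K * t) := by
  intro t ht
  have key := dist_le_of_trajectories_ODE_of_mem (v := fun _ => g) (s := fun _ => S)
    (a := 0) (b := T) (fun _ _ => hK)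
    (fun t ht => (hx t ht).continuousWithinAt)
    (fun t ht => (hx t (Ico_subset_Icc_self ht)).mono_of_mem_nhdsWithin
      (Icc_mem_nhdsGE_of_mem ht))
    (fun t ht => hxS t (Ico_subset_Icc_self ht))
    (fun t ht => (hy t ht).continuousWithinAt)
    (fun t ht => (hy t (Ico_subset_Icc_self ht)).mono_of_mem_nhdsWithin
      (Icc_mem_nhdsGE_of_mem ht))
    (fun t ht => hyS t (Ico_subset_Icc_self ht)) le_rfl t ht
  simpa using key

theorem eqOn_of_solutions_Icc {g : EuclideanSpace ℝ n → EuclideanSpace ℝ n}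
    (hg : LocallyLipschitz g) {x y : ℝ → EuclideanSpace ℝ n} {T : ℝ}
    (hx : ∀ t ∈ Icc 0 T, HasDerivWithinAt x (g (x t)) (Icc 0 T) t)
    (hy : ∀ t ∈ Icc 0 T, HasDerivWithinAt y (g (y t)) (Icc 0 T) t)
    (h0 : x 0 = y 0) : ∀ t ∈ Icc 0 T, x t = y t := by
  have hcx : IsCompact (x '' Icc 0 T) :=
    isCompact_Icc.image_of_continuousOn fun t ht => (hx t ht).continuousWithinAt
  have hcy : IsCompact (y '' Icc 0 T) :=
    isCompact_Icc.image_of_continuousOn fun t ht => (hy t ht).continuousWithinAt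
  obtain ⟨K, hK⟩ := LocallyLipschitzOn.exists_lipschitzOnWith_of_compact (hcx.union hcy)
    hg.locallyLipschitzOn
  intro t ht
  have := dist_le_of_solutions_Icc hK hx hy (fun t ht => Or.inl ⟨t, ht, rfl⟩)
    (fun t ht => Or.inr ⟨t, ht, rfl⟩) t ht
  rw [h0, dist_self, zero_mul] at this
  exact dist_le_zero.1 this

/-- A bounded locally Lipschitz vector field is forward complete. -/
theorem exists_trajectory_of_bounded {g : EuclideanSpace ℝ n → EuclideanSpace ℝ n}
    (hg : LocallyLipschitz g) {M : ℝ} (hM : ∀ x, ‖g x‖ ≤ M) (x₀ : EuclideanSpace ℝ n) :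
    ∃ x, IsTrajectory g x ∧ x 0 = x₀ := by
  choose X hX0 hX using fun N : ℕ =>
    exists_solution_Icc_of_bounded hg hM x₀ (T := (N : ℝ)) N.cast_nonneg
  have hcompat : ∀ (N N' : ℕ) (t : ℝ), 0 ≤ t → t ≤ N → t ≤ N' → X N t = X N' t := by
    have aux : ∀ (N N' : ℕ) (t : ℝ), N ≤ N' → 0 ≤ t → t ≤ N → X N t = X N' t := by
      intro N N' t hNN' h0 hN
      have hle : (N : ℝ) ≤ N' := by exact_mod_cast hNN'
      exact eqOn_of_solutions_Icc hg (hX N)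
        (fun s hs => (hX N' s ⟨hs.1, hs.2.trans hle⟩).mono (Icc_subset_Icc_right hle))
        ((hX0 N).trans (hX0 N').symm) t ⟨h0, hN⟩
    intro N N' t h0 hN hN'
    rcases le_total N N' with h | h
    · exact aux N N' t h h0 hN
    · exact (aux N' N t h h0 hN').symm
  -- The extra `1` puts `t` strictly below the end of the interval, so that the derivative within
  -- `[0, N]` is also one within `[0, ∞)`.
  refine ⟨fun t => X (⌈t⌉₊ + 1) t, ?_, by simp [hX0]⟩
  intro t ht
  set N : ℕ := ⌈t⌉₊ + 1 with hN
  have htN : t < N := by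
    have := Nat.le_ceil t
    push_cast [hN]; linarith
  have hd : HasDerivWithinAt (X N) (g (X N t)) (Ici 0) t :=
    (hX N t ⟨ht, htN.le⟩).mono_of_mem_nhdsWithin <| by
      rw [← Ici_inter_Iic]
      exact inter_mem self_mem_nhdsWithin (mem_nhdsWithin_of_mem_nhds (Iic_mem_nhds htN))
  refine hd.congr_of_eventuallyEq ?_ rfl
  filter_upwards [self_mem_nhdsWithin, mem_nhdsWithin_of_mem_nhds (Iio_mem_nhds htN)] with s hs hsN
  refine hcompat _ _ s hs ?_ (le_of_lt hsN)
  have := Nat.le_ceil s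
  push_cast; linarith

theorem IsTrajectory.hasDerivWithinAt_comp {g : EuclideanSpace ℝ n → EuclideanSpace ℝ n}
    {x : ℝ → EuclideanSpace ℝ n} (hx : IsTrajectory g x) {V : EuclideanSpace ℝ n → ℝ}
    (hV : Differentiable ℝ V) {t : ℝ} (ht : 0 ≤ t) :
    HasDerivWithinAt (fun s => V (x s)) (inner ℝ (gradient V (x t)) (g (x t))) (Ici 0) t := by
  rw [inner_gradient_left]
  exact (hV (x t)).hasFDerivAt.comp_hasDerivWithinAt t (hx t ht)

/-- A function with nonpositive orbital derivative decreases along trajectories. -/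
theorem IsTrajectory.antitoneOn_comp {g : EuclideanSpace ℝ n → EuclideanSpace ℝ n}
    {x : ℝ → EuclideanSpace ℝ n} (hx : IsTrajectory g x) {V : EuclideanSpace ℝ n → ℝ}
    (hV : Differentiable ℝ V) (hdec : ∀ y, inner ℝ (gradient V y) (g y) ≤ 0) :
    AntitoneOn (fun s => V (x s)) (Ici 0) := by
  refine antitoneOn_of_hasDerivWithinAt_nonpos (convex_Ici 0)
    (fun t ht => (hx.hasDerivWithinAt_comp hV ht).continuousWithinAt)
    (fun t ht => (hx.hasDerivWithinAt_comp hV (interior_subset ht)).mono interior_subset)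
    (fun t _ => hdec _)

theorem IsTrajectory.shift {g : EuclideanSpace ℝ n → EuclideanSpace ℝ n}
    {x : ℝ → EuclideanSpace ℝ n} (hx : IsTrajectory g x) {a : ℝ} (ha : 0 ≤ a) :
    IsTrajectory g (fun s => x (a + s)) := by
  intro t ht
  have h := (hx (a + t) (add_nonneg ha ht)).scomp (s := Ici 0) (h := fun s => a + s) (h' := 1) t
    (((hasDerivAt_id t).const_add a).hasDerivWithinAt)
    (fun s hs => add_nonneg ha hs)
  rw [one_smul] at h
  exact h

theorem IsTrajectory.hasDerivWithinAt_Icc {g : EuclideanSpace ℝ n → EuclideanSpace ℝ n}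
    {x : ℝ → EuclideanSpace ℝ n} (hx : IsTrajectory g x) (T : ℝ) :
    ∀ t ∈ Icc 0 T, HasDerivWithinAt x (g (x t)) (Icc 0 T) t :=
  fun t ht => (hx t ht.1).mono Icc_subset_Ici_self

/-- Trajectories exist for all forward time if some function with bounded sublevel sets has
nonpositive orbital derivative. -/
theorem exists_trajectory_of_lyapunov {g : EuclideanSpace ℝ n → EuclideanSpace ℝ n}
    (hg : LocallyLipschitz g) {V : EuclideanSpace ℝ n → ℝ} (hV : Differentiable ℝ V)
    (hbdd : ∀ C, ∃ r, ∀ x, V x ≤ C → ‖x‖ ≤ r)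
    (hdec : ∀ y, inner ℝ (gradient V y) (g y) ≤ 0) (x₀ : EuclideanSpace ℝ n) :
    ∃ x, IsTrajectory g x ∧ x 0 = x₀ := by
  obtain ⟨r, hr⟩ := hbdd (V x₀)
  have hr0 : 0 ≤ r := (norm_nonneg _).trans (hr x₀ le_rfl)
  -- Cutting the field off outside the sublevel set of `x₀` makes it bounded. The orbital derivative
  -- is only multiplied by `φ ≥ 0`, so the solution stays in the sublevel set, where `φ = 1` and the
  -- two fields agree.
  let φ : ContDiffBump (0 : EuclideanSpace ℝ n) :=
    ⟨r + 1, r + 2, by linarith, by linarith⟩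
  have hφ : LocallyLipschitz (φ : EuclideanSpace ℝ n → ℝ) :=
    ContDiff.locallyLipschitz (𝕂 := ℝ) φ.contDiff
  have hlip := hφ.smul_real hg
  have hsupp : HasCompactSupport (fun x => φ x • g x) := φ.hasCompactSupport.smul_right
  obtain ⟨M, hM⟩ := hsupp.exists_bound_of_continuous hlip.continuous
  obtain ⟨x, hx, hx0⟩ := exists_trajectory_of_bounded hlip hM x₀
  refine ⟨x, fun t ht => ?_, hx0⟩
  have hanti := hx.antitoneOn_comp hV fun y => by
    rw [inner_smul_right]
    exact mul_nonpos_of_nonneg_of_nonpos φ.nonneg (hdec y)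
  have hle : V (x t) ≤ V x₀ := by
    simpa [hx0] using hanti (mem_Ici.2 le_rfl) (mem_Ici.2 ht) ht
  have hone : φ (x t) = 1 := φ.one_of_mem_closedBall <| by
    rw [mem_closedBall_zero_iff]
    exact (hr _ hle).trans (by simp [φ])
  simpa [hone] using hx t ht

/-! ### Convex Lyapunov functions and LaSalle's principle -/

/-- A positive definite convex function grows at least linearly away from its minimizer. -/
theorem ConvexOn.exists_linear_growth {V : EuclideanSpace ℝ n → ℝ} (hconv : ConvexOn ℝ univ V)
    (hcont : Continuous V) {c : EuclideanSpace ℝ n} (hc : V c = 0) (hpos : ∀ x, x ≠ c → 0 < V x)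
    {ε : ℝ} (hε : 0 < ε) : ∃ a > 0, ∀ x, ε ≤ dist x c → a * dist x c ≤ V x := by
  -- Contract `x` radially onto the sphere of radius `ε`; since `V c = 0`, convexity scales the
  -- value by at most the contraction factor.
  have hray : ∀ x, ε ≤ dist x c → ∃ y ∈ Metric.sphere c ε, V y ≤ ε / dist x c * V x := by
    intro x hx
    have hd : 0 < dist x c := hε.trans_le hx
    have hq : ε / dist x c ≤ 1 := (div_le_one hd).2 hx
    refine ⟨(1 - ε / dist x c) • c + (ε / dist x c) • x, ?_, ?_⟩
    · rw [mem_sphere_iff_norm]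
      have : (1 - ε / dist x c) • c + (ε / dist x c) • x - c = (ε / dist x c) • (x - c) := by
        module
      rw [this, norm_smul, ← dist_eq_norm, Real.norm_of_nonneg (by positivity),
        div_mul_cancel₀ _ hd.ne']
    · have := hconv.2 (mem_univ c) (mem_univ x) (sub_nonneg.2 hq) (by positivity)
        (sub_add_cancel 1 (ε / dist x c))
      simpa [hc] using this
  rcases (Metric.sphere c ε).eq_empty_or_nonempty with he | hne
  -- In dimension zero the sphere is empty and no `x` is that far from `c`, so any slope will do.
  · refine ⟨1, one_pos, fun x hx => ?_⟩
    obtain ⟨y, hy, -⟩ := hray x hx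
    simp [he] at hy
  · obtain ⟨s, hs, hmin⟩ := (isCompact_sphere c ε).exists_isMinOn hne hcont.continuousOn
    have hsc : s ≠ c := by
      rintro rfl
      simp at hs
      exact hε.ne hs
    refine ⟨V s / ε, div_pos (hpos s hsc) hε, fun x hx => ?_⟩
    obtain ⟨y, hy, hyV⟩ := hray x hx
    have hd : 0 < dist x c := hε.trans_le hx
    have h : V s ≤ ε / dist x c * V x := (hmin hy).trans hyV
    calc V s / ε * dist x c ≤ (ε / dist x c * V x) / ε * dist x c := by gcongr
      _ = V x := by field_simp

/-- The Krasovskii–LaSalle theorem for a positive definite convex Lyapunov function. -/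
theorem globallyAsymptoticallyStable_of_convex_lyapunov
    {g : EuclideanSpace ℝ n → EuclideanSpace ℝ n}
    (hg : LocallyLipschitz g) {c : EuclideanSpace ℝ n} (hgc : g c = 0)
    {V : EuclideanSpace ℝ n → ℝ} (hV : ContDiff ℝ 1 V) (hconv : ConvexOn ℝ univ V)
    (hc : V c = 0) (hpos : ∀ x, x ≠ c → 0 < V x)
    (hdec : ∀ y, inner ℝ (gradient V y) (g y) ≤ 0)
    (hinv : ∀ x, IsTrajectory g x →
      (∀ t, 0 ≤ t → inner ℝ (gradient V (x t)) (g (x t)) = 0) → x 0 = c) :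
    GloballyAsymptoticallyStable g c := by
  have hdiff : Differentiable ℝ V := hV.differentiable one_ne_zero
  have hnonneg : ∀ x, 0 ≤ V x := fun x => by
    rcases eq_or_ne x c with rfl | h
    · exact hc.ge
    · exact (hpos x h).le
  have hball : ∀ C, ∃ r, ∀ x, V x ≤ C → x ∈ Metric.closedBall c r := by
    intro C
    obtain ⟨a, ha, hgrow⟩ := hconv.exists_linear_growth hV.continuous hc hpos one_pos
    -- The `1` ensures that the growth bound applies outside the ball; `C / a` makes it exceed `C`
    -- there.
    refine ⟨max 1 (C / a), fun x hx => Metric.mem_closedBall.2 ?_⟩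
    by_contra! hlt
    have h1 := (le_max_left _ _).trans hlt.le
    have h2 := (le_max_right _ _).trans_lt hlt
    rw [div_lt_iff₀ ha] at h2
    linarith [hgrow x h1]
  have hbdd : ∀ C, ∃ r, ∀ x, V x ≤ C → ‖x‖ ≤ r := fun C => by
    obtain ⟨r, hr⟩ := hball C
    exact ⟨r + ‖c‖, fun x hx => norm_le_of_mem_closedBall (hr x hx) |>.trans (by linarith)⟩
  have hex := exists_trajectory_of_lyapunov hg hdiff hbdd hdec
  refine ⟨⟨hgc, fun ε hε => ?_⟩, hex, fun x hx => ?_⟩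
  · obtain ⟨a, ha, hgrow⟩ := hconv.exists_linear_growth hV.continuous hc hpos hε
    have hev : ∀ᶠ y in 𝓝 c, V y < a * ε :=
      hV.continuous.continuousAt.eventually_lt continuousAt_const (by rw [hc]; positivity)
    obtain ⟨δ, hδ, hδV⟩ := Metric.eventually_nhds_iff.1 hev
    refine ⟨δ, hδ, fun x₀ hx₀ => ⟨hex x₀, fun x hx hx0 t ht => ?_⟩⟩
    by_contra! hle
    have h1 := hgrow _ hle
    have h2 : V (x t) ≤ V (x 0) :=
      hx.antitoneOn_comp hdiff hdec (mem_Ici.2 le_rfl) (mem_Ici.2 ht) ht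
    rw [hx0] at h2
    nlinarith [hδV hx₀]
  · have hanti := hx.antitoneOn_comp hdiff hdec
    obtain ⟨r, hr⟩ := hball (V (x 0))
    have hxK : ∀ t, 0 ≤ t → x t ∈ Metric.closedBall c r := fun t ht =>
      hr _ (hanti (mem_Ici.2 le_rfl) (mem_Ici.2 ht) ht)
    obtain ⟨l, hl⟩ : ∃ l, Tendsto (fun t => V (x t)) atTop (𝓝 l) := by
      -- Freezing the trajectory at negative times gives a function monotone on all of `ℝ`.
      have hmono : Antitone fun t => V (x (max t 0)) := fun s t hst =>
        hanti (mem_Ici.2 (le_max_right _ _)) (mem_Ici.2 (le_max_right _ _))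
          (max_le_max_right 0 hst)
      refine ⟨_, (tendsto_atTop_ciInf hmono ⟨0, ?_⟩).congr' ?_⟩
      · rintro _ ⟨t, rfl⟩
        exact hnonneg _
      · filter_upwards [eventually_ge_atTop 0] with t ht
        rw [max_eq_left ht]
    -- By compactness it suffices that `c` is the only cluster point.
    refine (isCompact_closedBall c r).tendsto_nhds_of_unique_mapClusterPt
      ((eventually_ge_atTop 0).mono hxK) fun z _ hz => ?_
    obtain ⟨U, hU, hUz⟩ := mapClusterPt_iff_ultrafilter.1 hz
    obtain ⟨y, hy, hy0⟩ := hex z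
    -- Continuous dependence: along the ultrafilter `x t` tends to `z`, so by Gronwall `x (t + s)`
    -- tends to `y s`. Since `V` along `x` tends to `l`, it equals `l` all along the trajectory from
    -- `z`.
    have hlim : ∀ s, 0 ≤ s → V (y s) = l := by
      intro s hs
      obtain ⟨r', hr'⟩ := hball (V z)
      have hyK : ∀ t, 0 ≤ t → y t ∈ Metric.closedBall c r' := fun t ht =>
        hr' _ (hy0 ▸ hy.antitoneOn_comp hdiff hdec (mem_Ici.2 le_rfl) (mem_Ici.2 ht) ht)
      obtain ⟨K, hK⟩ := hg.exists_lipschitzOnWith_closedBall c (max r r')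
      have hdist : ∀ᶠ t in (U : Filter ℝ),
          dist (x (t + s)) (y s) ≤ dist (x t) z * Real.exp (K * s) := by
        filter_upwards [hU (eventually_ge_atTop (0 : ℝ))] with t ht
        have := dist_le_of_solutions_Icc hK ((hx.shift ht).hasDerivWithinAt_Icc s)
          (hy.hasDerivWithinAt_Icc s)
          (fun τ hτ => Metric.closedBall_subset_closedBall (le_max_left _ _)
            (hxK _ (add_nonneg ht hτ.1)))
          (fun τ hτ => Metric.closedBall_subset_closedBall (le_max_right _ _) (hyK _ hτ.1))
          s ⟨hs, le_rfl⟩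
        simpa [hy0] using this
      have hxy : Tendsto (fun t => x (t + s)) U (𝓝 (y s)) := by
        rw [tendsto_iff_dist_tendsto_zero]
        refine squeeze_zero' (Eventually.of_forall fun _ => dist_nonneg) hdist ?_
        simpa using (tendsto_iff_dist_tendsto_zero.1 hUz).mul_const (Real.exp (K * s))
      exact tendsto_nhds_unique ((hV.continuous.tendsto _).comp hxy)
        ((hl.comp (tendsto_atTop_add_const_right atTop s tendsto_id)).mono_left hU)
    rw [← hy0]
    refine hinv y hy fun t ht => ?_
    have h1 := hy.hasDerivWithinAt_comp hdiff ht
    have h2 : HasDerivWithinAt (fun s => V (y s)) 0 (Ici 0) t :=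
      (hasDerivWithinAt_const t (Ici 0) l).congr (fun s hs => hlim s hs) (hlim t ht)
    exact (uniqueDiffOn_Ici (0 : ℝ) t ht).eq_deriv _ h1 h2

end ODE

/-! ### Block vectors and the supply rate as a quadratic form -/

theorem ContinuousLinearMap.locallyLipschitz_comp_prodMk {X E F G : Type*} [PseudoEMetricSpace X]
    [NormedAddCommGroup E] [NormedSpace ℝ E] [NormedAddCommGroup F] [NormedSpace ℝ F]
    [NormedAddCommGroup G] [NormedSpace ℝ G] (L : E × F →L[ℝ] G) {f : X → E} {g : X → F}
    (hf : LocallyLipschitz f) (hg : LocallyLipschitz g) :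
    LocallyLipschitz (fun x => L (f x, g x)) :=
  L.lipschitz.locallyLipschitz.comp (hf.prodMk hg)

section Blocks

variable {m p : Type}

/-- The upper block as a linear map. -/
def upperBlockₗ (m p : Type) : EuclideanSpace ℝ (m ⊕ p) →ₗ[ℝ] EuclideanSpace ℝ m where
  toFun := upperBlock
  map_add' _ _ := rfl
  map_smul' _ _ := rfl

/-- The lower block as a linear map. -/
def lowerBlockₗ (m p : Type) : EuclideanSpace ℝ (m ⊕ p) →ₗ[ℝ] EuclideanSpace ℝ p where
  toFun := lowerBlock
  map_add' _ _ := rfl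
  map_smul' _ _ := rfl

/-- Stacking as a linear map. -/
def stackₗ (m p : Type) :
    EuclideanSpace ℝ m × EuclideanSpace ℝ p →ₗ[ℝ] EuclideanSpace ℝ (m ⊕ p) where
  toFun z := stack z.1 z.2
  map_add' _ _ := by ext (i | i) <;> rfl
  map_smul' _ _ := by ext (i | i) <;> rfl

/-- The action of a matrix on Euclidean vectors as a linear map. -/
def mulEₗ [Fintype m] (A : Matrix p m ℝ) : EuclideanSpace ℝ m →ₗ[ℝ] EuclideanSpace ℝ p where
  toFun := mulE A
  map_add' x y := by simp [mulE, mulVec_add]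
  map_smul' r x := by simp [mulE, mulVec_smul]

theorem upperBlock_sub (x y : EuclideanSpace ℝ (m ⊕ p)) :
    upperBlock (x - y) = upperBlock x - upperBlock y := rfl

theorem lowerBlock_sub (x y : EuclideanSpace ℝ (m ⊕ p)) :
    lowerBlock (x - y) = lowerBlock x - lowerBlock y := rfl

@[simp] theorem upperBlock_stack (a : EuclideanSpace ℝ m) (b : EuclideanSpace ℝ p) :
    upperBlock (stack a b) = a := rfl

@[simp] theorem lowerBlock_stack (a : EuclideanSpace ℝ m) (b : EuclideanSpace ℝ p) :
    lowerBlock (stack a b) = b := rfl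

@[simp] theorem stack_blocks (x : EuclideanSpace ℝ (m ⊕ p)) :
    stack (upperBlock x) (lowerBlock x) = x := by ext (i | i) <;> rfl

theorem blocks_ext {x y : EuclideanSpace ℝ (m ⊕ p)} (hu : upperBlock x = upperBlock y)
    (hl : lowerBlock x = lowerBlock y) : x = y := by
  rw [← stack_blocks x, hu, hl, stack_blocks]

theorem stack_eq_zero_iff {a : EuclideanSpace ℝ m} {b : EuclideanSpace ℝ p} :
    stack a b = 0 ↔ a = 0 ∧ b = 0 := by
  refine ⟨fun h => ⟨congrArg upperBlock h, congrArg lowerBlock h⟩, ?_⟩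
  rintro ⟨rfl, rfl⟩
  ext (i | i) <;> rfl

theorem contDiff_upperBlock [Fintype m] [Fintype p] {k : WithTop ℕ∞} :
    ContDiff ℝ k (upperBlock : EuclideanSpace ℝ (m ⊕ p) → EuclideanSpace ℝ m) :=
  (LinearMap.toContinuousLinearMap (upperBlockₗ m p)).contDiff

theorem contDiff_lowerBlock [Fintype m] [Fintype p] {k : WithTop ℕ∞} :
    ContDiff ℝ k (lowerBlock : EuclideanSpace ℝ (m ⊕ p) → EuclideanSpace ℝ p) :=
  (LinearMap.toContinuousLinearMap (lowerBlockₗ m p)).contDiff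

theorem locallyLipschitz_mulE [Fintype m] [Fintype p] (A : Matrix p m ℝ) :
    LocallyLipschitz (mulE A) :=
  (LinearMap.toContinuousLinearMap (mulEₗ A)).lipschitz.locallyLipschitz

theorem locallyLipschitz_stack {X : Type*} [PseudoEMetricSpace X] [Fintype m] [Fintype p]
    {f : X → EuclideanSpace ℝ m} {g : X → EuclideanSpace ℝ p}
    (hf : LocallyLipschitz f) (hg : LocallyLipschitz g) :
    LocallyLipschitz (fun x => stack (f x) (g x)) :=
  (LinearMap.toContinuousLinearMap (stackₗ m p)).locallyLipschitz_comp_prodMk hf hg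

@[simp] theorem ofLp_stack (a : EuclideanSpace ℝ m) (b : EuclideanSpace ℝ p) :
    (stack a b).ofLp = Sum.elim a.ofLp b.ofLp := rfl

theorem inner_eq_dotProduct [Fintype m] (x y : EuclideanSpace ℝ m) :
    inner ℝ x y = x.ofLp ⬝ᵥ y.ofLp := by
  rw [EuclideanSpace.inner_eq_star_dotProduct, dotProduct_comm]
  simp

theorem dotProduct_transpose_mulVec' [Fintype m] [Fintype p] (A : Matrix p m ℝ) (x : m → ℝ)
    (y : p → ℝ) : x ⬝ᵥ Aᵀ *ᵥ y = y ⬝ᵥ A *ᵥ x := by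
  rw [mulVec_transpose, dotProduct_comm, dotProduct_mulVec]

theorem Matrix.IsSymm.dotProduct_mulVec_comm [Fintype m] {A : Matrix m m ℝ} (hA : A.IsSymm)
    (x y : m → ℝ) : x ⬝ᵥ A *ᵥ y = y ⬝ᵥ A *ᵥ x := by
  conv_lhs => rw [← hA.eq, dotProduct_transpose_mulVec']

theorem supply_eq_dotProduct [Fintype m] [Fintype p] (Q : Matrix p p ℝ) (S : Matrix p m ℝ)
    (R : Matrix m m ℝ) (u : EuclideanSpace ℝ m) (y : EuclideanSpace ℝ p) :
    supply Q S R u y =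
      y.ofLp ⬝ᵥ Q *ᵥ y.ofLp + 2 * (y.ofLp ⬝ᵥ S *ᵥ u.ofLp) + u.ofLp ⬝ᵥ R *ᵥ u.ofLp := by
  simp only [supply, inner_eq_dotProduct, mulE, stack, fromBlocks_mulVec,
    sumElim_dotProduct_sumElim, Sum.elim_comp_inl, Sum.elim_comp_inr, dotProduct_add,
    dotProduct_transpose_mulVec']
  ring

/-- The supply rate of the closed loop is the weighted sum of the supply rates of the parts. -/
theorem supply_closedLoop [Fintype m] [Fintype p] (κ : ℝ)
    (Q₁ : Matrix p p ℝ) (S₁ : Matrix p m ℝ) {R₁ : Matrix m m ℝ}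
    (Q₂ : Matrix m m ℝ) (S₂ : Matrix m p ℝ) {R₂ : Matrix p p ℝ}
    (hR₁ : R₁.IsSymm) (hR₂ : R₂.IsSymm)
    (v : EuclideanSpace ℝ (m ⊕ p)) (y : EuclideanSpace ℝ (p ⊕ m)) :
    supply (Qcl κ Q₁ S₁ R₁ Q₂ S₂ R₂) (Scl κ S₁ R₁ S₂ R₂) (Rcl κ R₁ R₂) v y =
      supply Q₁ S₁ R₁ (upperBlock v - lowerBlock y) (upperBlock y) +
        κ * supply Q₂ S₂ R₂ (lowerBlock v + upperBlock y) (lowerBlock y) := by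
  obtain ⟨v₁, v₂, rfl⟩ : ∃ a b, v = stack a b := ⟨_, _, (stack_blocks v).symm⟩
  obtain ⟨y₁, y₂, rfl⟩ : ∃ a b, y = stack a b := ⟨_, _, (stack_blocks y).symm⟩
  simp only [supply_eq_dotProduct, upperBlock_stack, lowerBlock_stack, Qcl, Scl, Rcl, ofLp_stack,
    fromBlocks_mulVec, sumElim_dotProduct_sumElim, Sum.elim_comp_inl, Sum.elim_comp_inr,
    dotProduct_add, add_mulVec, dotProduct_transpose_mulVec', neg_mulVec, smul_mulVec,
    dotProduct_neg, dotProduct_smul, smul_eq_mul, WithLp.ofLp_sub, WithLp.ofLp_add, mulVec_sub,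
    mulVec_add, sub_dotProduct, dotProduct_sub, add_dotProduct, zero_mulVec, dotProduct_zero]
  -- Up to the symmetry of `R₁` and `R₂` in these two cross terms, both sides have the same
  -- monomials.
  rw [hR₁.dotProduct_mulVec_comm v₁.ofLp y₂.ofLp, hR₂.dotProduct_mulVec_comm v₂.ofLp y₁.ofLp]
  ring

end Blocks

/-! ### Bregman distances of convex functions -/

section Bregman

variable {n : Type} [Fintype n] {V : EuclideanSpace ℝ n → ℝ} {c : EuclideanSpace ℝ n}

@[simp] theorem bregman_self : bregman V c c = 0 := by simp [bregman]

theorem contDiff_bregman (hV : ContDiff ℝ 1 V) : ContDiff ℝ 1 (bregman V c) :=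
  (hV.sub contDiff_const).sub (contDiff_const.inner ℝ (contDiff_id.sub contDiff_const))

theorem hasFDerivAt_bregman (hV : Differentiable ℝ V) (x : EuclideanSpace ℝ n) :
    HasFDerivAt (bregman V c) (fderiv ℝ V x - innerSL ℝ (gradient V c)) x :=
  ((hV x).hasFDerivAt.sub_const _).sub
    ((innerSL ℝ (gradient V c)).hasFDerivAt.comp x ((hasFDerivAt_id x).sub_const c))

theorem fderiv_bregman (hV : Differentiable ℝ V) (x w : EuclideanSpace ℝ n) :
    fderiv ℝ (bregman V c) x w = inner ℝ (gradient V x - gradient V c) w := by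
  rw [(hasFDerivAt_bregman hV x).fderiv, inner_sub_left, inner_gradient_left]
  rfl

/-- The Bregman distance differs from `V` by an affine function, which does not change the convexity
defect. -/
theorem bregman_combination (a b : ℝ) (hab : a + b = 1) (x y : EuclideanSpace ℝ n) :
    bregman V c (a • x + b • y) - (a * bregman V c x + b * bregman V c y) =
      V (a • x + b • y) - (a * V x + b * V y) := by
  have h : a • x + b • y - c = a • (x - c) + b • (y - c) := by
    obtain rfl : b = 1 - a := by linarith
    module
  simp only [bregman, h, inner_add_right, inner_smul_right]
  linear_combination V c * hab

theorem ConvexOn.bregman (hV : ConvexOn ℝ univ V) : ConvexOn ℝ univ (bregman V c) := by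
  refine ⟨convex_univ, fun x _ y _ a b ha hb hab => ?_⟩
  have h := hV.2 (mem_univ x) (mem_univ y) ha hb hab
  have := bregman_combination (V := V) (c := c) a b hab x y
  simp only [smul_eq_mul] at h ⊢
  linarith

theorem StrictConvexOn.bregman (hV : StrictConvexOn ℝ univ V) :
    StrictConvexOn ℝ univ (bregman V c) := by
  refine ⟨convex_univ, fun x _ y _ hxy a b ha hb hab => ?_⟩
  have h := hV.2 (mem_univ x) (mem_univ y) hxy ha hb hab
  have := bregman_combination (V := V) (c := c) a b hab x y
  simp only [smul_eq_mul] at h ⊢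
  linarith

/-- The first-order characterization of convexity. -/
theorem bregman_nonneg (hV : Differentiable ℝ V) (hconv : ConvexOn ℝ univ V)
    (x : EuclideanSpace ℝ n) : 0 ≤ bregman V c x := by
  -- Restricted to the line through `c` and `x`, the claim is that the derivative at `0` is at most
  -- the slope over `[0, 1]`.
  have hd : HasDerivAt (fun t : ℝ => V (AffineMap.lineMap c x t))
      (inner ℝ (gradient V c) (x - c)) 0 := by
    rw [inner_gradient_left]
    have h1 : HasFDerivAt V (fderiv ℝ V c) (AffineMap.lineMap c x (0 : ℝ)) := by
      simpa using (hV c).hasFDerivAt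
    exact h1.comp_hasDerivAt (0 : ℝ) AffineMap.hasDerivAt_lineMap
  have hc : ConvexOn ℝ univ (fun t : ℝ => V (AffineMap.lineMap c x t)) :=
    hconv.comp_affineMap (AffineMap.lineMap c x)
  have := hc.le_slope_of_hasDerivAt (mem_univ 0) (mem_univ 1) one_pos hd
  simp only [slope, sub_zero, inv_one, one_smul, vsub_eq_sub, AffineMap.lineMap_apply_one,
    AffineMap.lineMap_apply_zero] at this
  simp only [_root_.bregman]
  linarith

theorem bregman_pos (hV : Differentiable ℝ V) (hconv : StrictConvexOn ℝ univ V)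
    {x : EuclideanSpace ℝ n} (hx : x ≠ c) : 0 < bregman V c x := by
  refine (bregman_nonneg hV hconv.convexOn x).lt_of_ne' fun h0 => ?_
  -- A second zero at `x` would make the value at the midpoint negative.
  have h := (hconv.bregman (c := c)).2 (mem_univ x) (mem_univ c) hx one_half_pos one_half_pos
    (add_halves 1)
  rw [h0, bregman_self] at h
  have := bregman_nonneg (c := c) hV hconv.convexOn ((1 / 2 : ℝ) • x + (1 / 2 : ℝ) • c)
  simp at h this
  linarith

end Bregman

/-! ### Equilibrium inputs and dissipativity of one system -/

namespace ControlAffine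

variable {n m p : Type} [Fintype n] [Fintype m] [Fintype p]

theorem output_sub_output (sys : ControlAffine n m p) (u ubar : EuclideanSpace ℝ m)
    (x xbar : EuclideanSpace ℝ n) :
    sys.output u x - sys.output ubar xbar = (sys.h x - sys.h xbar) + mulE sys.J (u - ubar) := by
  have : mulE sys.J (u - ubar) = mulE sys.J u - mulE sys.J ubar := map_sub (mulEₗ sys.J) u ubar
  rw [this, output, output]
  abel

theorem field_sub_field (sys : ControlAffine n m p) (u ubar : EuclideanSpace ℝ m)
    (x xbar : EuclideanSpace ℝ n) :
    sys.field u x - sys.field ubar xbar = (sys.f x - sys.f xbar) + mulE sys.G (u - ubar) := by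
  have : mulE sys.G (u - ubar) = mulE sys.G u - mulE sys.G ubar := map_sub (mulEₗ sys.G) u ubar
  rw [this, field, field]
  abel

/-- If `G` is injective, the equilibrium input is unique and given by `ku`. -/
theorem ku_eq [DecidableEq m] (sys : ControlAffine n m p)
    (hG : Function.Injective sys.G.mulVec) {u : EuclideanSpace ℝ m} {x : EuclideanSpace ℝ n}
    (h : sys.field u x = 0) : sys.ku x = u := by
  -- Injectivity of `G` makes its Gram matrix invertible, so the left inverse in `ku` recovers `u`.
  have hpd : (sys.Gᵀ * sys.G).PosDef := by
    simpa using Matrix.PosDef.conjTranspose_mul_self sys.G hG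
  have hf : sys.f x = -mulE sys.G u := eq_neg_of_add_eq_zero_left h
  have hdet := (Matrix.isUnit_iff_isUnit_det _).1 hpd.isUnit
  apply WithLp.ofLp_injective
  rw [ku, hf]
  simp only [mulE, WithLp.ofLp_neg, mulVec_neg, mulVec_mulVec, neg_neg]
  rw [Matrix.mul_assoc, Matrix.nonsing_inv_mul _ hdet, one_mulVec]

/-- The Hill–Moylan conditions imply the incremental dissipation inequality. -/
theorem HillMoylanEID.inner_le_supply {sys : ControlAffine n m p} {V : EuclideanSpace ℝ n → ℝ}
    {Q : Matrix p p ℝ} {S : Matrix p m ℝ} {R : Matrix m m ℝ} (h : sys.HillMoylanEID V Q S R)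
    (hQ : Q.IsSymm) {ubar : EuclideanSpace ℝ m} {xbar : EuclideanSpace ℝ n}
    (hbar : sys.field ubar xbar = 0) (u : EuclideanSpace ℝ m) (x : EuclideanSpace ℝ n) :
    inner ℝ (gradient V x - gradient V xbar) (sys.field u x) ≤
      supply Q S R (u - ubar) (sys.output u x - sys.output ubar xbar) := by
  obtain ⟨-, -, -, k, -, W, l, h1, h2, h3⟩ := h
  have hx : xbar ∈ sys.assignable := ⟨ubar, hbar⟩
  have hfield : sys.field u x = (sys.f x - sys.f xbar) + mulE sys.G (u - ubar) := by
    rw [← field_sub_field, hbar, sub_zero]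
  rw [hfield, output_sub_output, inner_add_right, h1 x xbar hx, supply_eq_dotProduct]
  set d := u - ubar
  have e2 := congrArg (· ⬝ᵥ d.ofLp) (h2 x xbar hx)
  have e3 := congrArg (fun M => d.ofLp ⬝ᵥ M *ᵥ d.ofLp) h3
  have hnorm : ‖l x xbar‖ ^ 2 = (l x xbar).ofLp ⬝ᵥ (l x xbar).ofLp := by
    rw [← inner_eq_dotProduct, real_inner_self_eq_norm_sq]
  -- This square is exactly the gap in the claimed inequality; the cross terms come from the second
  -- Hill–Moylan equation paired with `d`, the term in `W` alone from the third.
  have hsq : 0 ≤ ((l x xbar).ofLp + W *ᵥ d.ofLp) ⬝ᵥ ((l x xbar).ofLp + W *ᵥ d.ofLp) := by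
    simpa using dotProduct_star_self_nonneg ((l x xbar).ofLp + W *ᵥ d.ofLp)
  rw [hnorm]
  simp only [inner_eq_dotProduct, mulE, WithLp.ofLp_add]
  generalize (l x xbar).ofLp = l at *
  generalize (sys.h x - sys.h xbar).ofLp = z at *
  generalize (gradient V x - gradient V xbar).ofLp = q at *
  generalize d.ofLp = d at *
  have hcomm : sys.J *ᵥ d ⬝ᵥ Q *ᵥ z = z ⬝ᵥ Q *ᵥ sys.J *ᵥ d := hQ.dotProduct_mulVec_comm _ _
  have hT : ∀ (a : Type) [Fintype a] (A : Matrix a m ℝ) (b : a → ℝ),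
      d ⬝ᵥ Aᵀ *ᵥ b = A *ᵥ d ⬝ᵥ b := fun a _ A b => by
    rw [dotProduct_transpose_mulVec', dotProduct_comm]
  simp only [smul_dotProduct, sub_dotProduct, ← dotProduct_mulVec, add_mulVec, dotProduct_add,
    ← mulVec_mulVec, hT, smul_eq_mul] at e2 e3
  have hS : S *ᵥ d ⬝ᵥ sys.J *ᵥ d = sys.J *ᵥ d ⬝ᵥ S *ᵥ d := dotProduct_comm _ _
  have hl : W *ᵥ d ⬝ᵥ l = l ⬝ᵥ W *ᵥ d := dotProduct_comm _ _
  simp only [dotProduct_add, add_dotProduct, mulVec_add] at hsq ⊢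
  linarith

end ControlAffine

/-! ### The feedback interconnection -/

section ClosedLoop

variable {n₁ n₂ m p : Type} [Fintype n₁] [Fintype n₂] [Fintype m] [Fintype p]
  [DecidableEq m] [DecidableEq p]
  {sys₁ : ControlAffine n₁ m p} {sys₂ : ControlAffine n₂ p m}

/-- The outputs that solve the algebraic loop are the closed-loop outputs. -/
theorem feedback_output_eq (hJ : IsUnit (1 + sys₁.J * sys₂.J))
    {v : EuclideanSpace ℝ (m ⊕ p)} {x : EuclideanSpace ℝ (n₁ ⊕ n₂)}
    {y₁ : EuclideanSpace ℝ p} {y₂ : EuclideanSpace ℝ m}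
    (h₁ : y₁ = sys₁.output (upperBlock v - y₂) (upperBlock x))
    (h₂ : y₂ = sys₂.output (lowerBlock v + y₁) (lowerBlock x)) :
    (feedback sys₁ sys₂).output v x = stack y₁ y₂ := by
  obtain ⟨k₁, k₂, -⟩ := feedback_spec sys₁ sys₂ hJ v x
  set y := (feedback sys₁ sys₂).output v x
  have e₁ : upperBlock y - y₁ = mulE sys₁.J (y₂ - lowerBlock y) := by
    have := sys₁.output_sub_output (upperBlock v - lowerBlock y) (upperBlock v - y₂)
      (upperBlock x) (upperBlock x)
    rw [← k₁, ← h₁, sub_self, zero_add] at this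
    rw [this]; congr 1; abel
  have e₂ : lowerBlock y - y₂ = mulE sys₂.J (upperBlock y - y₁) := by
    have := sys₂.output_sub_output (lowerBlock v + upperBlock y) (lowerBlock v + y₁)
      (lowerBlock x) (lowerBlock x)
    rw [← k₂, ← h₂, sub_self, zero_add] at this
    rw [this]; congr 1; abel
  have e₃ : y₂ - lowerBlock y = -mulE sys₂.J (upperBlock y - y₁) := by rw [← e₂]; abel
  -- Eliminating the second output deviation leaves a homogeneous equation for the first, with the
  -- invertible loop matrix.
  have hz : (1 + sys₁.J * sys₂.J) *ᵥ (upperBlock y - y₁).ofLp = 0 := by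
    rw [e₃] at e₁
    have := congrArg WithLp.ofLp e₁
    simp only [mulE, WithLp.ofLp_neg, mulVec_neg, mulVec_mulVec] at this
    rw [add_mulVec, one_mulVec]
    exact add_eq_zero_iff_eq_neg.2 this
  have hz' : (upperBlock y - y₁).ofLp = 0 :=
    Matrix.mulVec_injective_of_isUnit hJ (by simpa using hz)
  have hu : upperBlock y - y₁ = 0 := WithLp.ofLp_injective _ hz'
  refine blocks_ext (sub_eq_zero.1 hu) (sub_eq_zero.1 ?_)
  rw [lowerBlock_stack, e₂, hu]
  exact map_zero (mulEₗ sys₂.J)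

/-- The assignable equilibria of the closed loop are the pairs of assignable equilibria. -/
theorem mem_assignable_feedback_iff (hJ : IsUnit (1 + sys₁.J * sys₂.J))
    (x : EuclideanSpace ℝ (n₁ ⊕ n₂)) :
    x ∈ (feedback sys₁ sys₂).assignable ↔
      upperBlock x ∈ sys₁.assignable ∧ lowerBlock x ∈ sys₂.assignable := by
  constructor
  · rintro ⟨v, hv⟩
    rw [(feedback_spec sys₁ sys₂ hJ v x).2.2, stack_eq_zero_iff] at hv
    exact ⟨⟨_, hv.1⟩, ⟨_, hv.2⟩⟩
  · rintro ⟨⟨u₁, h₁⟩, ⟨u₂, h₂⟩⟩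
    set y₁ := sys₁.output u₁ (upperBlock x) with hy₁
    set y₂ := sys₂.output u₂ (lowerBlock x) with hy₂
    -- The external input is found by solving the interconnection equations for `v`.
    have hout : (feedback sys₁ sys₂).output (stack (u₁ + y₂) (u₂ - y₁)) x = stack y₁ y₂ :=
      feedback_output_eq hJ (by simp [hy₁]) (by simp [hy₂])
    refine ⟨stack (u₁ + y₂) (u₂ - y₁), ?_⟩
    rw [(feedback_spec sys₁ sys₂ hJ _ x).2.2, stack_eq_zero_iff, hout]
    simpa using ⟨h₁, h₂⟩

/-- The closed-loop input matrix is injective if both input matrices are. -/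
theorem feedback_G_injective (hJ : IsUnit (1 + sys₁.J * sys₂.J))
    (hG₁ : Function.Injective sys₁.G.mulVec) (hG₂ : Function.Injective sys₂.G.mulVec) :
    Function.Injective (feedback sys₁ sys₂).G.mulVec := by
  -- The closed-loop `G` depends only on the matrices `G` and `J` of the parts, so drift and output
  -- map may be set to zero. A kernel vector then forces zero inputs to both parts, hence zero
  -- outputs, hence `v = 0`.
  let lin₁ : ControlAffine n₁ m p := ⟨0, sys₁.G, 0, sys₁.J⟩
  let lin₂ : ControlAffine n₂ p m := ⟨0, sys₂.G, 0, sys₂.J⟩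
  have hker : ∀ v : EuclideanSpace ℝ (m ⊕ p), mulE (feedback sys₁ sys₂).G v = 0 → v = 0 := by
    intro v hv
    obtain ⟨k₁, k₂, k₃⟩ := feedback_spec lin₁ lin₂ hJ v 0
    have hf : (feedback lin₁ lin₂).f 0 = 0 := by
      have hs : (stack 0 0 : EuclideanSpace ℝ (p ⊕ m)) = 0 := stack_eq_zero_iff.2 ⟨rfl, rfl⟩
      have hs' : (stack 0 0 : EuclideanSpace ℝ (n₁ ⊕ n₂)) = 0 := stack_eq_zero_iff.2 ⟨rfl, rfl⟩
      simp only [feedback, lin₁, lin₂, Pi.zero_apply, hs, hs', zero_add]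
      exact map_zero (mulEₗ _)
    have hfield : (feedback lin₁ lin₂).field v 0 = 0 := by
      rw [ControlAffine.field, hf, zero_add]
      exact hv
    rw [hfield, eq_comm, stack_eq_zero_iff] at k₃
    have u₁ : upperBlock v - lowerBlock ((feedback lin₁ lin₂).output v 0) = 0 :=
      WithLp.ofLp_injective _ (hG₁ (by
        simpa [lin₁, ControlAffine.field, mulE] using congrArg WithLp.ofLp k₃.1))
    have u₂ : lowerBlock v + upperBlock ((feedback lin₁ lin₂).output v 0) = 0 :=
      WithLp.ofLp_injective _ (hG₂ (by
        simpa [lin₂, ControlAffine.field, mulE] using congrArg WithLp.ofLp k₃.2))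
    rw [u₁] at k₁
    rw [u₂] at k₂
    have y₁ : upperBlock ((feedback lin₁ lin₂).output v 0) = 0 := by
      rw [k₁]; simp [lin₁, ControlAffine.output, mulE]
    have y₂ : lowerBlock ((feedback lin₁ lin₂).output v 0) = 0 := by
      rw [k₂]; simp [lin₂, ControlAffine.output, mulE]
    rw [y₂, sub_zero] at u₁
    rw [y₁, add_zero] at u₂
    exact blocks_ext u₁ u₂
  intro a b hab
  have := hker (WithLp.toLp 2 (a - b)) (by
    simp only [mulE]
    rw [mulVec_sub, sub_eq_zero.2 hab]
    rfl)
  have h0 : a - b = 0 := congrArg WithLp.ofLp this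
  exact sub_eq_zero.1 h0

theorem locallyLipschitz_feedback_field (hf₁ : LocallyLipschitz sys₁.f)
    (hh₁ : LocallyLipschitz sys₁.h) (hf₂ : LocallyLipschitz sys₂.f)
    (hh₂ : LocallyLipschitz sys₂.h) (v : EuclideanSpace ℝ (m ⊕ p)) :
    LocallyLipschitz ((feedback sys₁ sys₂).field v) := by
  have hu : LocallyLipschitz (upperBlock : EuclideanSpace ℝ (n₁ ⊕ n₂) → _) :=
    contDiff_upperBlock (k := 1) |>.locallyLipschitz
  have hl : LocallyLipschitz (lowerBlock : EuclideanSpace ℝ (n₁ ⊕ n₂) → _) :=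
    contDiff_lowerBlock (k := 1) |>.locallyLipschitz
  exact ((locallyLipschitz_stack (hf₁.comp hu) (hf₂.comp hl)).add
    ((locallyLipschitz_mulE _).comp (locallyLipschitz_stack (hh₁.comp hu) (hh₂.comp hl)))).add
    (LocallyLipschitz.const _)

/-- The composite storage function of the closed loop. -/
noncomputable def compositeStorage (κ : ℝ) (V₁ : EuclideanSpace ℝ n₁ → ℝ) (V₂ : EuclideanSpace ℝ n₂ → ℝ)
    (xbar x : EuclideanSpace ℝ (n₁ ⊕ n₂)) : ℝ :=
  bregman V₁ (upperBlock xbar) (upperBlock x) + κ * bregman V₂ (lowerBlock xbar) (lowerBlock x)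

variable {V₁ : EuclideanSpace ℝ n₁ → ℝ} {V₂ : EuclideanSpace ℝ n₂ → ℝ} {κ : ℝ}
  {xbar : EuclideanSpace ℝ (n₁ ⊕ n₂)}

theorem contDiff_compositeStorage (hV₁ : ContDiff ℝ 1 V₁) (hV₂ : ContDiff ℝ 1 V₂) :
    ContDiff ℝ 1 (compositeStorage κ V₁ V₂ xbar) :=
  ((contDiff_bregman hV₁).comp contDiff_upperBlock).add
    (contDiff_const.mul ((contDiff_bregman hV₂).comp contDiff_lowerBlock))

/-- Chain rule through the two block projections. Pairing with stacked vectors suffices because the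
closed-loop field is stacked. -/
theorem inner_gradient_compositeStorage (hV₁ : Differentiable ℝ V₁) (hV₂ : Differentiable ℝ V₂)
    (x : EuclideanSpace ℝ (n₁ ⊕ n₂)) (w₁ : EuclideanSpace ℝ n₁) (w₂ : EuclideanSpace ℝ n₂) :
    inner ℝ (gradient (compositeStorage κ V₁ V₂ xbar) x) (stack w₁ w₂) =
      inner ℝ (gradient V₁ (upperBlock x) - gradient V₁ (upperBlock xbar)) w₁ +
        κ * inner ℝ (gradient V₂ (lowerBlock x) - gradient V₂ (lowerBlock xbar)) w₂ := by
  have h₁ := (hasFDerivAt_bregman (c := upperBlock xbar) hV₁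
    (upperBlock x)).differentiableAt.hasFDerivAt.comp x
      (LinearMap.toContinuousLinearMap (upperBlockₗ n₁ n₂)).hasFDerivAt
  have h₂ := (hasFDerivAt_bregman (c := lowerBlock xbar) hV₂
    (lowerBlock x)).differentiableAt.hasFDerivAt.comp x
      (LinearMap.toContinuousLinearMap (lowerBlockₗ n₁ n₂)).hasFDerivAt
  have h := h₁.add (h₂.const_mul κ)
  rw [inner_gradient_left, ← fderiv_bregman hV₁, ← fderiv_bregman hV₂]
  exact congrArg (fun A => A (stack w₁ w₂)) h.fderiv

theorem compositeStorage_self : compositeStorage κ V₁ V₂ xbar xbar = 0 := by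
  simp [compositeStorage]

theorem compositeStorage_nonneg (hκ : 0 ≤ κ) (hV₁ : Differentiable ℝ V₁)
    (hV₂ : Differentiable ℝ V₂) (hc₁ : ConvexOn ℝ univ V₁) (hc₂ : ConvexOn ℝ univ V₂)
    (x : EuclideanSpace ℝ (n₁ ⊕ n₂)) : 0 ≤ compositeStorage κ V₁ V₂ xbar x :=
  add_nonneg (bregman_nonneg hV₁ hc₁ _) (mul_nonneg hκ (bregman_nonneg hV₂ hc₂ _))

theorem compositeStorage_pos (hκ : 0 < κ) (hV₁ : Differentiable ℝ V₁)
    (hV₂ : Differentiable ℝ V₂) (hc₁ : StrictConvexOn ℝ univ V₁) (hc₂ : StrictConvexOn ℝ univ V₂)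
    {x : EuclideanSpace ℝ (n₁ ⊕ n₂)} (hx : x ≠ xbar) : 0 < compositeStorage κ V₁ V₂ xbar x := by
  by_cases hu : upperBlock x = upperBlock xbar
  · have hl : lowerBlock x ≠ lowerBlock xbar := fun hl => hx (blocks_ext hu hl)
    exact add_pos_of_nonneg_of_pos (bregman_nonneg hV₁ hc₁.convexOn _)
      (mul_pos hκ (bregman_pos hV₂ hc₂ hl))
  · exact add_pos_of_pos_of_nonneg (bregman_pos hV₁ hc₁ hu)
      (mul_nonneg hκ.le (bregman_nonneg hV₂ hc₂.convexOn _))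

theorem convexOn_compositeStorage (hκ : 0 ≤ κ) (hc₁ : ConvexOn ℝ univ V₁)
    (hc₂ : ConvexOn ℝ univ V₂) : ConvexOn ℝ univ (compositeStorage κ V₁ V₂ xbar) :=
  (hc₁.bregman.comp_linearMap (upperBlockₗ n₁ n₂)).add
    ((hc₂.bregman.comp_linearMap (lowerBlockₗ n₁ n₂)).smul hκ)

/-- The dissipation inequality of the closed loop. -/
theorem inner_gradient_compositeStorage_le_supply
    {Q₁ : Matrix p p ℝ} {S₁ : Matrix p m ℝ} {R₁ : Matrix m m ℝ}
    {Q₂ : Matrix m m ℝ} {S₂ : Matrix m p ℝ} {R₂ : Matrix p p ℝ}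
    (hJ : IsUnit (1 + sys₁.J * sys₂.J))
    (hQ₁ : Q₁.IsSymm) (hR₁ : R₁.IsSymm) (hQ₂ : Q₂.IsSymm) (hR₂ : R₂.IsSymm)
    (hHM₁ : sys₁.HillMoylanEID V₁ Q₁ S₁ R₁) (hHM₂ : sys₂.HillMoylanEID V₂ Q₂ S₂ R₂)
    (hκ : 0 < κ) {vbar : EuclideanSpace ℝ (m ⊕ p)}
    (hbar : (feedback sys₁ sys₂).field vbar xbar = 0)
    (v : EuclideanSpace ℝ (m ⊕ p)) (x : EuclideanSpace ℝ (n₁ ⊕ n₂)) :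
    inner ℝ (gradient (compositeStorage κ V₁ V₂ xbar) x) ((feedback sys₁ sys₂).field v x) ≤
      supply (Qcl κ Q₁ S₁ R₁ Q₂ S₂ R₂) (Scl κ S₁ R₁ S₂ R₂) (Rcl κ R₁ R₂) (v - vbar)
        ((feedback sys₁ sys₂).output v x - (feedback sys₁ sys₂).output vbar xbar) := by
  obtain ⟨b₁, b₂, b₃⟩ := feedback_spec sys₁ sys₂ hJ vbar xbar
  obtain ⟨k₁, k₂, k₃⟩ := feedback_spec sys₁ sys₂ hJ v x
  rw [b₃, stack_eq_zero_iff] at hbar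
  have d₁ := hHM₁.inner_le_supply hQ₁ hbar.1
    (upperBlock v - lowerBlock ((feedback sys₁ sys₂).output v x)) (upperBlock x)
  have d₂ := hHM₂.inner_le_supply hQ₂ hbar.2
    (lowerBlock v + upperBlock ((feedback sys₁ sys₂).output v x)) (lowerBlock x)
  rw [← k₁, ← b₁] at d₁
  rw [← k₂, ← b₂] at d₂
  rw [k₃, inner_gradient_compositeStorage (hHM₁.2.1.differentiable one_ne_zero)
    (hHM₂.2.1.differentiable one_ne_zero), supply_closedLoop κ Q₁ S₁ Q₂ S₂ hR₁ hR₂]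
  refine add_le_add (d₁.trans_eq ?_) (mul_le_mul_of_nonneg_left (d₂.trans_eq ?_) hκ.le)
  · simp only [upperBlock_sub, lowerBlock_sub]
    congr 1; abel
  · simp only [upperBlock_sub, lowerBlock_sub]
    congr 1; abel

/-- Constant-input closed-loop stability when the closed-loop output weight is negative
definite. -/
theorem feedback_globallyAsymptoticallyStable
    {Q₁ : Matrix p p ℝ} {S₁ : Matrix p m ℝ} {R₁ : Matrix m m ℝ}
    {Q₂ : Matrix m m ℝ} {S₂ : Matrix m p ℝ} {R₂ : Matrix p p ℝ}
    (hf₁ : LocallyLipschitz sys₁.f) (hh₁ : LocallyLipschitz sys₁.h)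
    (hf₂ : LocallyLipschitz sys₂.f) (hh₂ : LocallyLipschitz sys₂.h)
    (hG₁ : Function.Injective sys₁.G.mulVec) (hG₂ : Function.Injective sys₂.G.mulVec)
    (hJ : IsUnit (1 + sys₁.J * sys₂.J))
    (hQ₁ : Q₁.IsSymm) (hR₁ : R₁.IsSymm) (hQ₂ : Q₂.IsSymm) (hR₂ : R₂.IsSymm)
    (hHM₁ : sys₁.HillMoylanEID V₁ Q₁ S₁ R₁) (hHM₂ : sys₂.HillMoylanEID V₂ Q₂ S₂ R₂)
    (hs₁ : StrictConvexOn ℝ univ V₁) (hs₂ : StrictConvexOn ℝ univ V₂)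
    (ho₁ : sys₁.EIObservable) (ho₂ : sys₂.EIObservable)
    (hκ : 0 < κ) (hpd : (-Qcl κ Q₁ S₁ R₁ Q₂ S₂ R₂).PosDef)
    {vbar : EuclideanSpace ℝ (m ⊕ p)} (hbar : (feedback sys₁ sys₂).field vbar xbar = 0) :
    (∀ x, (feedback sys₁ sys₂).field vbar x = 0 ↔ x = xbar) ∧
      GloballyAsymptoticallyStable ((feedback sys₁ sys₂).field vbar) xbar := by
  have hV₁ := hHM₁.2.1.differentiable one_ne_zero
  have hV₂ := hHM₂.2.1.differentiable one_ne_zero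
  set g := (feedback sys₁ sys₂).field vbar with hg
  set V := compositeStorage κ V₁ V₂ xbar
  -- With `v = vbar` only the `Qcl` term of the supply rate survives, and it is negative unless the
  -- output deviation is zero.
  have hstrict : ∀ x, inner ℝ (gradient V x) (g x) ≤ 0 ∧
      (inner ℝ (gradient V x) (g x) = 0 →
        (feedback sys₁ sys₂).output vbar x = (feedback sys₁ sys₂).output vbar xbar) := by
    intro x
    have h := inner_gradient_compositeStorage_le_supply hJ hQ₁ hR₁ hQ₂ hR₂ hHM₁ hHM₂ hκ hbar vbar x
    rw [sub_self, supply_eq_dotProduct] at h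
    simp only [WithLp.ofLp_zero, mulVec_zero, dotProduct_zero, mul_zero, add_zero] at h
    set d := (feedback sys₁ sys₂).output vbar x - (feedback sys₁ sys₂).output vbar xbar with hd
    by_cases h0 : d = 0
    · exact ⟨h.trans_eq (by simp [h0]), fun _ => sub_eq_zero.1 h0⟩
    · have hne : d.ofLp ≠ 0 := fun h' => h0 (WithLp.ofLp_injective _ h')
      have hlt := hpd.dotProduct_mulVec_pos hne
      simp only [star_trivial, neg_mulVec, dotProduct_neg] at hlt
      have : inner ℝ (gradient V x) (g x) < 0 := by linarith
      exact ⟨this.le, fun h' => absurd h' this.ne⟩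
  obtain ⟨b₁, b₂, b₃⟩ := feedback_spec sys₁ sys₂ hJ vbar xbar
  have hbar' := hbar
  rw [hg, b₃, stack_eq_zero_iff] at hbar'
  have hku₁ := sys₁.ku_eq hG₁ hbar'.1
  have hku₂ := sys₂.ku_eq hG₂ hbar'.2
  have hinv : ∀ x, IsTrajectory g x →
      (∀ t, 0 ≤ t → inner ℝ (gradient V (x t)) (g (x t)) = 0) → x 0 = xbar := by
    intro x hx hzero
    have hout := fun t ht => (hstrict (x t)).2 (hzero t ht)
    -- Once the output is frozen at its equilibrium value, the internal inputs are the equilibrium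
    -- inputs and the loop splits into two autonomous systems.
    have hspec : ∀ t, 0 ≤ t →
        upperBlock ((feedback sys₁ sys₂).output vbar xbar) =
          sys₁.output (sys₁.ku (upperBlock xbar)) (upperBlock (x t)) ∧
        lowerBlock ((feedback sys₁ sys₂).output vbar xbar) =
          sys₂.output (sys₂.ku (lowerBlock xbar)) (lowerBlock (x t)) ∧
        g (x t) = stack (sys₁.field (sys₁.ku (upperBlock xbar)) (upperBlock (x t)))
          (sys₂.field (sys₂.ku (lowerBlock xbar)) (lowerBlock (x t))) := by
      intro t ht
      have := feedback_spec sys₁ sys₂ hJ vbar (x t)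
      rw [hout t ht] at this
      rw [hku₁, hku₂]
      exact this
    have hx₁ : IsTrajectory (sys₁.field (sys₁.ku (upperBlock xbar)))
        (fun t => upperBlock (x t)) := by
      intro t ht
      have h := (LinearMap.toContinuousLinearMap (upperBlockₗ n₁ n₂)).hasFDerivAt.comp_hasDerivWithinAt
        t (hx t ht)
      rw [(hspec t ht).2.2] at h
      exact h
    have hx₂ : IsTrajectory (sys₂.field (sys₂.ku (lowerBlock xbar)))
        (fun t => lowerBlock (x t)) := by
      intro t ht
      have h := (LinearMap.toContinuousLinearMap (lowerBlockₗ n₁ n₂)).hasFDerivAt.comp_hasDerivWithinAt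
        t (hx t ht)
      rw [(hspec t ht).2.2] at h
      exact h
    refine blocks_ext (ho₁ _ ⟨_, hbar'.1⟩ _ hx₁ (fun t ht => ?_) 0 le_rfl)
      (ho₂ _ ⟨_, hbar'.2⟩ _ hx₂ (fun t ht => ?_) 0 le_rfl)
    · rw [← (hspec t ht).1, b₁, ControlAffine.ky, hku₁]
    · rw [← (hspec t ht).2.1, b₂, ControlAffine.ky, hku₂]
  refine ⟨fun x => ⟨fun hx => ?_, fun hx => hx ▸ hbar⟩, ?_⟩
  -- Another equilibrium would be a constant trajectory with zero orbital derivative.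
  · refine hinv (fun _ => x) (fun t _ => ?_) fun t _ => by rw [hx, inner_zero_right]
    rw [hx]
    exact hasDerivWithinAt_const t _ x
  · exact globallyAsymptoticallyStable_of_convex_lyapunov
      (locallyLipschitz_feedback_field hf₁ hh₁ hf₂ hh₂ vbar) hbar
      (contDiff_compositeStorage hHM₁.2.1 hHM₂.2.1)
      (convexOn_compositeStorage hκ.le hHM₁.2.2.1 hHM₂.2.2.1) compositeStorage_self
      (fun x hx => compositeStorage_pos hκ hV₁ hV₂ hs₁ hs₂ hx) (fun y => (hstrict y).1) hinv

theorem GloballyAsymptoticallyStable.locally {n : Type} [Fintype n]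
    {g : EuclideanSpace ℝ n → EuclideanSpace ℝ n} {c : EuclideanSpace ℝ n}
    (h : GloballyAsymptoticallyStable g c) : LocallyAsymptoticallyStable g c :=
  ⟨h.1, 1, one_pos, fun x hx _ => h.2.2 x hx⟩

end ClosedLoop

/-! ### Full column rank and the main theorem -/

theorem Matrix.mulVec_injective_of_rank_eq {m n : Type*} [Fintype m] [Fintype n]
    (A : Matrix m n ℝ) (hA : A.rank = Fintype.card n) : Function.Injective A.mulVec := by
  have h := A.mulVecLin.finrank_range_add_finrank_ker
  rw [Module.finrank_fintype_fun_eq_card, ← hA] at h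
  have hk : Module.finrank ℝ (LinearMap.ker A.mulVecLin) = 0 := by
    have : A.rank = Module.finrank ℝ (LinearMap.range A.mulVecLin) := rfl
    omega
  exact LinearMap.ker_eq_bot.1 (Submodule.finrank_eq_zero.1 hk)

theorem theorem1 {n₁ n₂ m p : ℕ}
    (sys₁ : ControlAffine (Fin n₁) (Fin m) (Fin p))
    (sys₂ : ControlAffine (Fin n₂) (Fin p) (Fin m))
    -- standing assumptions on the two systems
    (hf₁ : LocallyLipschitz sys₁.f) (hh₁ : LocallyLipschitz sys₁.h) (hG₁ : sys₁.G.rank = m)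
    (hf₂ : LocallyLipschitz sys₂.f) (hh₂ : LocallyLipschitz sys₂.h) (hG₂ : sys₂.G.rank = p)
    -- well-posedness of the interconnection
    (hJ : IsUnit (1 + sys₁.J * sys₂.J))
    -- supply parameters and storage functions of the two systems
    (Q₁ : Matrix (Fin p) (Fin p) ℝ) (S₁ : Matrix (Fin p) (Fin m) ℝ)
    (R₁ : Matrix (Fin m) (Fin m) ℝ)
    (Q₂ : Matrix (Fin m) (Fin m) ℝ) (S₂ : Matrix (Fin m) (Fin p) ℝ)
    (R₂ : Matrix (Fin p) (Fin p) ℝ)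
    (hQ₁ : Q₁.IsSymm) (hR₁ : R₁.IsSymm) (hQ₂ : Q₂.IsSymm) (hR₂ : R₂.IsSymm)
    (V₁ : EuclideanSpace ℝ (Fin n₁) → ℝ) (V₂ : EuclideanSpace ℝ (Fin n₂) → ℝ)
    (hHM₁ : sys₁.HillMoylanEID V₁ Q₁ S₁ R₁) (hHM₂ : sys₂.HillMoylanEID V₂ Q₂ S₂ R₂)
    -- unique solvability of the closed-loop equilibrium inclusions
    (heq : ∀ (v₁ : EuclideanSpace ℝ (Fin m)) (v₂ : EuclideanSpace ℝ (Fin p)),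
      ∃! y : EuclideanSpace ℝ (Fin p) × EuclideanSpace ℝ (Fin m),
        (v₁ - y.2, y.1) ∈ sys₁.ioRelation ∧ (v₂ + y.1, y.2) ∈ sys₂.ioRelation) :
    -- the assignable equilibria of the closed loop
    (∀ x, x ∈ (feedback sys₁ sys₂).assignable ↔
      upperBlock x ∈ sys₁.assignable ∧ lowerBlock x ∈ sys₂.assignable) ∧
    -- dissipativity of the closed loop
    (∀ κ : ℝ, 0 < κ →
      (feedback sys₁ sys₂).IsEIDWith
        (supply (Qcl κ Q₁ S₁ R₁ Q₂ S₂ R₂) (Scl κ S₁ R₁ S₂ R₂) (Rcl κ R₁ R₂))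
        (fun xbar x =>
          bregman V₁ (upperBlock xbar) (upperBlock x) + κ * bregman V₂ (lowerBlock xbar) (lowerBlock x))) ∧
    -- stability of the closed loop
    (StrictConvexOn ℝ univ V₁ → StrictConvexOn ℝ univ V₂ →
      sys₁.EIObservable → sys₂.EIObservable →
      (∃ κ : ℝ, 0 < κ ∧ (-Qcl κ Q₁ S₁ R₁ Q₂ S₂ R₂).PosDef) →
      ∀ xbar ∈ (feedback sys₁ sys₂).assignable,
        (∀ x, (feedback sys₁ sys₂).field ((feedback sys₁ sys₂).ku xbar) x = 0 ↔ x = xbar) ∧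
        LocallyAsymptoticallyStable
          ((feedback sys₁ sys₂).field ((feedback sys₁ sys₂).ku xbar)) xbar ∧
        ((∃ μ : ℝ, 0 < μ ∧ StrongConvexOn univ μ V₁) →
          (∃ μ : ℝ, 0 < μ ∧ StrongConvexOn univ μ V₂) →
          GloballyAsymptoticallyStable
            ((feedback sys₁ sys₂).field ((feedback sys₁ sys₂).ku xbar)) xbar)) := by
  have hi₁ := sys₁.G.mulVec_injective_of_rank_eq (by simpa using hG₁)
  have hi₂ := sys₂.G.mulVec_injective_of_rank_eq (by simpa using hG₂)
  have hi := feedback_G_injective hJ hi₁ hi₂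
  refine ⟨mem_assignable_feedback_iff hJ, fun κ hκ xbar hxbar => ?_,
    fun hs₁ hs₂ ho₁ ho₂ hpd xbar hxbar => ?_⟩
  · obtain ⟨vbar, hbar⟩ := hxbar
    refine ⟨contDiff_compositeStorage hHM₁.2.1 hHM₂.2.1,
      compositeStorage_nonneg hκ.le (hHM₁.2.1.differentiable one_ne_zero)
        (hHM₂.2.1.differentiable one_ne_zero) hHM₁.2.2.1 hHM₂.2.2.1,
      compositeStorage_self, fun x v => ?_⟩
    -- Injectivity of the closed-loop `G` identifies the chosen `vbar` with `ku xbar`.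
    rw [ControlAffine.ky, ControlAffine.ku_eq _ hi hbar]
    exact inner_gradient_compositeStorage_le_supply hJ hQ₁ hR₁ hQ₂ hR₂ hHM₁ hHM₂ hκ hbar v x
  · obtain ⟨vbar, hbar⟩ := hxbar
    obtain ⟨κ, hκ, hpd⟩ := hpd
    rw [ControlAffine.ku_eq _ hi hbar]
    obtain ⟨huniq, hgas⟩ := feedback_globallyAsymptoticallyStable hf₁ hh₁ hf₂ hh₂ hi₁ hi₂ hJ
      hQ₁ hR₁ hQ₂ hR₂ hHM₁ hHM₂ hs₁ hs₂ ho₁ ho₂ hκ hpd hbar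
    exact ⟨huniq, hgas.locally, fun _ _ => hgas⟩
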